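/- Equip $\mathcal P(\omega)$ with the Cantor topology (identify subsets of $\omega$ with their characteristic functions in $2^\omega$), and equip ${}^\omega(\mathcal P(\omega))$ and its square with the product topologies. For a quasi-order (reflexive and transitive relation) $S$ on $X$, let $S^{\mathrm{inj}}$ be the quasi-order on ${}^\omega X$ given by $$(x_n)_{n\in\omega} \mathrel{S^{\mathrm{inj}}} (y_n)_{n\in\omega} \iff \exists f\colon\omega\to\omega \text{ injective such that } \forall n\ (x_n \mathrel{S} y_{f(n)}),$$ and for a quasi-order $R$ let $E_R$ be the associated equivalence relation, $x \mathrel{E_R} y \iff x \mathrel{R} y \wedge y \mathrel{R} x$. A subset $A$ of a Polish space $X$ is called $\boldsymbol\Sigma^1_1$-complete if it is analytic and for every zero-dimensional Polish space $Z$ and every analytic $B \subseteq Z$ there is a continuous $f\colon Z \to X$ with $B = f^{-1}(A)$. Then: (1) The upper cone $\{\vec x \mid \vec p \subseteq^{\mathrm{inj}} \vec x\}$ in $(\mathcal P(\omega),\subseteq)^{\mathrm{inj}}$ generated by $\vec p = (\{n\})_{n\in\omega}$ is a $\boldsymbol\Sigma^1_1$-complete subset of ${}^\omega(\mathcal P(\omega))$.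 In particular, $\subseteq^{\mathrm{inj}}$ is a $\boldsymbol\Sigma^1_1$-complete (hence non-Borel) subset of ${}^\omega(\mathcal P(\omega)) \times {}^\omega(\mathcal P(\omega))$. (2) The lower cone $\{\vec x \mid \vec x \subseteq^{\mathrm{inj}} \vec q\}$ in $(\mathcal P(\omega),\subseteq)^{\mathrm{inj}}$ generated by $\vec q = (\omega\setminus\{n\})_{n\in\omega}$ is a $\boldsymbol\Sigma^1_1$-complete subset of ${}^\omega(\mathcal P(\omega))$. (3) The equivalence relation $E_{(\mathcal P(\omega),\subseteq)^{\mathrm{inj}}}$ is a $\boldsymbol\Sigma^1_1$-complete subset of ${}^\omega(\mathcal P(\omega)) \times {}^\omega(\mathcal P(\omega))$. Hence the jump $S \mapsto S^{\mathrm{inj}}$ of a Borel quasi-order can be proper analytic: $\subseteq$ is a Borel quasi-order on $\mathcal P(\omega)$, whereas $\subseteq^{\mathrm{inj}}$ is an analytic quasi-order that is not Borel. -/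

import Mathlib

open Set MeasureTheory

/-- The identification of `𝒫(ω)` with `2^ω` through characteristic functions. -/
noncomputable def charFunEquiv : Set ℕ ≃ (ℕ → Bool) := by
  classical
  exact
    { toFun := fun A n => decide (n ∈ A)
      invFun := fun c => {n | c n = true}
      left_inv := fun A => by ext n; simp
      right_inv := fun c => by ext n; simp }

/-- The Cantor topology on `𝒫(ω)`. -/
noncomputable instance instTopologicalSpaceSetNat : TopologicalSpace (Set ℕ) :=
  TopologicalSpace.induced charFunEquiv inferInstance

instance instPolishSpaceSetNat : PolishSpace (Set ℕ) :=
  haveI : PolishSpace Bool :=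
    (Topology.IsClosedEmbedding.of_continuous_injective_isClosedMap (f := Bool.toNat)
      continuous_of_discreteTopology (by decide) (fun _ _ => isClosed_discrete _)).polishSpace
  charFunEquiv.polishSpace_induced

/-- A subset `A` of a Polish space `X` is `𝚺¹₁`-complete: it is analytic, and every analytic
subset of every zero-dimensional Polish space is the preimage of `A` under a continuous map. -/
def IsSigma11Complete {X : Type*} [TopologicalSpace X] [PolishSpace X] (A : Set X) : Prop :=
  AnalyticSet A ∧
    ∀ (Z : Type) [TopologicalSpace Z] [PolishSpace Z],
      TopologicalSpace.IsTopologicalBasis {s : Set Z | IsClopen s} →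
        ∀ B : Set Z, AnalyticSet B → ∃ f : Z → X, Continuous f ∧ f ⁻¹' A = B

/-- The relation `S^inj` on `X^ω`. -/
def injJump {X : Type*} (S : X → X → Prop) (x y : ℕ → X) : Prop :=
  ∃ f : ℕ → ℕ, Function.Injective f ∧ ∀ n, S (x n) (y (f n))

/-- The equivalence relation `E_S` associated to a quasi-order `S`. -/
def assocEquiv {X : Type*} (S : X → X → Prop) (x y : X) : Prop :=
  S x y ∧ S y x

/-- The jump of a quasi-order is a quasi-order. -/
theorem injJump_isPreorder {X : Type*} (S : X → X → Prop) (hS : IsPreorder X S) :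
    IsPreorder (ℕ → X) (injJump S) :=
  { refl := fun x => ⟨id, Function.injective_id, fun n => hS.refl (x n)⟩
    trans := by
      rintro x y z ⟨f, hf, hxy⟩ ⟨g, hg, hyz⟩
      exact ⟨g ∘ f, hg.comp hf, fun n => hS.trans _ _ _ (hxy n) (hyz (f n))⟩ }

/-- The relation associated to a quasi-order is an equivalence relation. -/
theorem assocEquiv_equivalence {X : Type*} (S : X → X → Prop) (hS : IsPreorder X S) :
    Equivalence (assocEquiv S) :=
  ⟨fun x => ⟨hS.refl x, hS.refl x⟩, fun h => ⟨h.2, h.1⟩,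
    fun h k => ⟨hS.trans _ _ _ h.1 k.1, hS.trans _ _ _ k.2 h.2⟩⟩

/-- The upper cone generated by `p`. -/
def upperCone {X : Type*} (S : X → X → Prop) (p : X) : Set X := {x | S p x}

/-- The lower cone generated by `q`. -/
def lowerCone {X : Type*} (S : X → X → Prop) (q : X) : Set X := {x | S x q}

/-- A binary relation as a subset of the square. -/
def relGraph {X : Type*} (S : X → X → Prop) : Set (X × X) := {z | S z.1 z.2}

/-- A Borel quasi-order: reflexive, transitive, and Borel as a subset of the square. -/
def IsBorelQuasiOrder {X : Type*} [TopologicalSpace X] (S : X → X → Prop) : Prop :=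
  IsPreorder X S ∧ MeasurableSet[borel (X × X)] (relGraph S)

/-- A proper analytic quasi-order: reflexive, transitive, and analytic but not Borel as a subset
of the square. -/
def IsProperAnalyticQuasiOrder {X : Type*} [TopologicalSpace X] (S : X → X → Prop) : Prop :=
  IsPreorder X S ∧ AnalyticSet (relGraph S) ∧ ¬ MeasurableSet[borel (X × X)] (relGraph S)

/-- The inclusion relation on `𝒫(ω)`. -/
def powIncl (A B : Set ℕ) : Prop := A ⊆ B

/-! ### Continuity in the Cantor topology on `𝒫(ω)` -/

/-! Upper bound: `injJump S` is a projection along the closed set of injections in Baire space.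
Lower bound: if an analytic set is the range of a continuous `g`, then `z` belongs to it iff the
tree of finite approximations to a `g`-preimage of `z` has an infinite branch, and membership of a
fixed node in this tree is a clopen condition on `z`. A branch can be detected by an injection. Let
each node either stay put or move to an extension in the tree, and forbid the value `[]`. Then `[]`
has to move, and by injectivity its orbit can never stop, so it climbs a branch; conversely, a
branch yields a shift along itself (`hasShift_approxTree_iff`). It remains to choose families of
sets for which inclusion of the `m`-th in the `n`-th says exactly that node `m` may move to node
`n`. Non-Borelness follows by diagonalizing a universal closed set. -/

theorem isClopen_setOf_mem (n : ℕ) : IsClopen {A : Set ℕ | n ∈ A} := by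
  have h : Continuous fun A : Set ℕ => charFunEquiv A n :=
    (continuous_apply n).comp continuous_induced_dom
  have h' := (isClopen_discrete {true}).preimage h
  convert h' using 1
  ext A
  simp [charFunEquiv]

theorem continuous_set_nat {Z : Type*} [TopologicalSpace Z] {F : Z → Set ℕ}
    (h : ∀ n, IsClopen {z | n ∈ F z}) : Continuous F := by
  refine continuous_induced_rng.2 (continuous_pi fun n => ?_)
  refine (continuous_bool_rng true).2 ?_
  convert h n using 1
  ext z
  simp [charFunEquiv]

theorem isClosed_relGraph_powIncl : IsClosed (relGraph powIncl) := by
  have : relGraph powIncl = ⋂ n : ℕ, {z : Set ℕ × Set ℕ | n ∈ z.1 → n ∈ z.2} := by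
    ext z
    simp [relGraph, powIncl, Set.subset_def]
  rw [this]
  refine isClosed_iInter fun n => ?_
  simp only [imp_iff_not_or, ofPred_or]
  exact ((isClopen_setOf_mem n).compl.preimage continuous_fst).isClosed.union
    ((isClopen_setOf_mem n).preimage continuous_snd).isClosed

theorem powIncl_isPreorder : IsPreorder (Set ℕ) powIncl :=
  { refl := fun A => Subset.refl A
    trans := fun _ _ _ h k => Subset.trans h k }

/-! ### Analyticity -/

theorem IsClosed.analyticSet_relGraph_injJump {X : Type*} [TopologicalSpace X] [PolishSpace X]
    {S : X → X → Prop} (hS : IsClosed (relGraph S)) : AnalyticSet (relGraph (injJump S)) := by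
  have hC : IsClosed {w : ((ℕ → X) × (ℕ → X)) × (ℕ → ℕ) |
      Function.Injective w.2 ∧ ∀ n, S (w.1.1 n) (w.1.2 (w.2 n))} := by
    have h₁ : IsClosed {w : ((ℕ → X) × (ℕ → X)) × (ℕ → ℕ) | Function.Injective w.2} := by
      simp only [Function.Injective, ofPred_forall]
      refine isClosed_iInter fun a => isClosed_iInter fun b => ?_
      have hc : Continuous fun w : ((ℕ → X) × (ℕ → X)) × (ℕ → ℕ) => (w.2 a, w.2 b) := by
        fun_prop
      exact (isClosed_discrete {p : ℕ × ℕ | p.1 = p.2 → a = b}).preimage hc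
    have h₂ : IsClosed {w : ((ℕ → X) × (ℕ → X)) × (ℕ → ℕ) |
        ∀ n, S (w.1.1 n) (w.1.2 (w.2 n))} := by
      -- Splitting over the value `k` of `w.2 n` leaves only fixed coordinates to evaluate.
      have : {w : ((ℕ → X) × (ℕ → X)) × (ℕ → ℕ) | ∀ n, S (w.1.1 n) (w.1.2 (w.2 n))} =
          ⋂ n, ⋂ k, ({w | w.2 n ≠ k} ∪ {w | S (w.1.1 n) (w.1.2 k)}) := by
        ext w
        simp only [mem_ofPred_eq, mem_iInter, mem_union]
        exact ⟨fun h n k => or_iff_not_imp_left.2 fun hk => not_not.1 hk ▸ h n,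
          fun h n => (h n (w.2 n)).resolve_left (by simp)⟩
      rw [this]
      refine isClosed_iInter fun n => isClosed_iInter fun k => IsClosed.union ?_ ?_
      · have hc : Continuous fun w : ((ℕ → X) × (ℕ → X)) × (ℕ → ℕ) => w.2 n := by fun_prop
        exact (isClosed_discrete {k}ᶜ).preimage hc
      · have hc : Continuous fun w : ((ℕ → X) × (ℕ → X)) × (ℕ → ℕ) => (w.1.1 n, w.1.2 k) := by
          fun_prop
        exact hS.preimage hc
    exact h₁.inter h₂
  convert hC.analyticSet.image_of_continuous continuous_fst using 1
  ext w
  simp [relGraph, injJump]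

theorem AnalyticSet.relGraph_assocEquiv {X : Type*} [TopologicalSpace X] [PolishSpace X]
    {S : X → X → Prop} (hS : AnalyticSet (relGraph S)) : AnalyticSet (relGraph (assocEquiv S)) := by
  have h := AnalyticSet.iInter (s := fun b : Bool =>
    if b then relGraph S else Prod.swap ⁻¹' relGraph S) (by
      rintro (_ | _)
      · simpa using hS.preimage continuous_swap
      · simpa using hS)
  convert h using 1
  ext w
  simp [relGraph, assocEquiv, and_comm]

/-! ### Shifts along a set of finite sequences -/

/-- `t` is nonempty and either equals `s` or is an element of `T` extending `s`. Finite sequences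
are written in reverse order, as in `PiNat.res`, so that extensions are given by suffixes. -/
def ExtendsIn (T : Set (List ℕ)) (s t : List ℕ) : Prop :=
  t ≠ [] ∧ (s = t ∨ (s <:+ t ∧ t ∈ T))

/-- There is an injection sending each finite sequence to itself or to an extension in `T`, and
avoiding the empty sequence. -/
def HasShift (T : Set (List ℕ)) : Prop :=
  ∃ f : List ℕ → List ℕ, Function.Injective f ∧ ∀ s, ExtendsIn T s (f s)

theorem PiNat.res_suffix_res {α : Type*} (b : ℕ → α) {m n : ℕ} (h : m ≤ n) :
    PiNat.res b m <:+ PiNat.res b n := by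
  induction n, h using Nat.le_induction with
  | base => exact List.suffix_rfl
  | succ n _ ih => exact ih.trans (List.suffix_cons _ _)

theorem PiNat.eq_of_res_suffix_res {α : Type*} {b c : ℕ → α} {m n : ℕ}
    (h : PiNat.res b m <:+ PiNat.res c n) {k : ℕ} (hk : k < m) : b k = c k := by
  have hmn : m ≤ n := by simpa using h.length_le
  have h' := List.suffix_of_suffix_length_le h (PiNat.res_suffix_res c hmn) (by simp)
  exact PiNat.res_eq_res.1 (h'.eq_of_length (by simp)) hk

/-- Initial segments of `b` move up by one and all else is fixed. As `[]` is the initial segment of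
length `0`, it moves and is not a value. -/
theorem hasShift_of_branch {T : Set (List ℕ)} (b : ℕ → ℕ) (hb : ∀ n, PiNat.res b n ∈ T) :
    HasShift T := by
  classical
  refine ⟨fun s => if s = PiNat.res b s.length then PiNat.res b (s.length + 1) else s, ?_, ?_⟩
  · intro s t h
    dsimp only at h
    split_ifs at h with hs ht ht
    · have hl := congrArg List.length h
      simp only [PiNat.res_length] at hl
      rw [hs, ht, Nat.succ_injective hl]
    · exact absurd (by rw [← h, PiNat.res_length]) ht
    · exact absurd (by rw [h, PiNat.res_length]) hs
    · exact h
  · intro s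
    dsimp only
    split_ifs with hs
    · refine ⟨by simp [PiNat.res_succ], Or.inr ⟨?_, hb _⟩⟩
      conv_lhs => rw [hs]
      exact PiNat.res_suffix_res b (Nat.le_succ _)
    · refine ⟨?_, Or.inl rfl⟩
      rintro rfl
      exact hs (by simp)

/-- Iterating a shift from the empty sequence gives a strictly increasing sequence in `T`. -/
theorem HasShift.exists_chain {T : Set (List ℕ)} (h : HasShift T) :
    ∃ u : ℕ → List ℕ, (∀ n, u n ∈ T) ∧ (∀ n, n < (u n).length) ∧ ∀ m n, m ≤ n → u m <:+ u n := by
  obtain ⟨f, hf, hT⟩ := h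
  -- If the orbit stalled, cancelling the injective `f^[n]` would give `f [] = []`, which is
  -- forbidden.
  have hne : ∀ n, f^[n] [] ≠ f^[n + 1] [] := by
    intro n hn
    rw [Function.iterate_succ_apply] at hn
    exact (hT []).1 ((hf.iterate n) hn).symm
  have hstep : ∀ n, f^[n] [] <:+ f^[n + 1] [] ∧ f^[n + 1] [] ∈ T := by
    intro n
    have h := (hT (f^[n] [])).2
    rw [← Function.iterate_succ_apply' f] at h
    exact h.resolve_left (hne n)
  have hlen : ∀ n, n ≤ (f^[n] []).length := by
    intro n
    induction n with
    | zero => exact Nat.zero_le _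
    | succ n ih =>
      exact ih.trans_lt (lt_of_le_of_ne (hstep n).1.length_le
        fun h => hne n ((hstep n).1.eq_of_length h))
  -- The orbit is taken from its second term on, since `[]` itself need not lie in `T`.
  refine ⟨fun n => f^[n + 1] [], fun n => (hstep n).2, fun n => hlen (n + 1), fun m n hmn => ?_⟩
  induction n, hmn using Nat.le_induction with
  | base => exact List.suffix_rfl
  | succ n _ ih => exact ih.trans (hstep (n + 1)).1

/-! ### Reducing analytic sets to the existence of shifts -/

theorem exists_isClopen_seq_separating {Z : Type*} [TopologicalSpace Z] [T2Space Z]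
    [SecondCountableTopology Z] [Nonempty Z]
    (hZ : TopologicalSpace.IsTopologicalBasis {s : Set Z | IsClopen s}) :
    ∃ U : ℕ → Set Z, (∀ n, IsClopen (U n)) ∧ ∀ x y, (∀ n, x ∈ U n ↔ y ∈ U n) → x = y := by
  obtain ⟨b, hb, hbc, hbasis⟩ := hZ.exists_countable
  have hne : b.Nonempty := by
    obtain ⟨z⟩ := ‹Nonempty Z›
    obtain ⟨s, hs, -⟩ := hbasis.exists_subset_of_mem_open (mem_univ z) isOpen_univ
    exact ⟨s, hs⟩
  obtain ⟨U, rfl⟩ := hbc.exists_eq_range hne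
  refine ⟨U, fun n => hb ⟨n, rfl⟩, fun x y h => ?_⟩
  by_contra hxy
  obtain ⟨V, hV, hxV, hVy⟩ := hbasis.exists_subset_of_mem_open
    (show x ∈ ({y}ᶜ : Set Z) from hxy) isOpen_compl_singleton
  obtain ⟨n, rfl⟩ := hV
  exact hVy ((h n).1 hxV) rfl

/-- The truth of `P` depends on finitely many of the clopen sets, so it is locally constant. -/
theorem isClopen_of_iff {Z : Type*} [TopologicalSpace Z] {U : ℕ → Set Z}
    (hU : ∀ n, IsClopen (U n)) {P : Z → Prop} (N : ℕ)
    (hP : ∀ x y, (∀ k < N, x ∈ U k ↔ y ∈ U k) → P x → P y) : IsClopen {z | P z} := by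
  have hopen : ∀ z, IsOpen {x | ∀ k < N, x ∈ U k ↔ z ∈ U k} := by
    intro z
    have : {x | ∀ k < N, x ∈ U k ↔ z ∈ U k} = ⋂ k ∈ Iio N, {x | x ∈ U k ↔ z ∈ U k} := by
      ext; simp
    rw [this]
    refine (finite_Iio N).isOpen_biInter fun k _ => ?_
    by_cases hz : z ∈ U k
    · simpa [hz] using (hU k).isOpen
    · simpa only [hz, iff_false] using! (hU k).compl.isOpen
  constructor
  · rw [← isOpen_compl_iff, isOpen_iff_forall_mem_open]
    exact fun z hz => ⟨_, fun x hx hPx => hz (hP x z hx hPx), hopen z, fun _ _ => Iff.rfl⟩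
  · rw [isOpen_iff_forall_mem_open]
    exact fun z hz => ⟨_, fun x hx => hP z x (fun k hk => (hx k hk).symm) hz, hopen z,
      fun _ _ => Iff.rfl⟩

/-- The finite sequences with an extension whose image under `g` agrees with `z` on as many of the
sets `U k` as the length of the sequence. -/
def approxTree {Z : Type*} (U : ℕ → Set Z) (g : (ℕ → ℕ) → Z) (z : Z) : Set (List ℕ) :=
  {t | ∃ y, t = PiNat.res y t.length ∧ ∀ k < t.length, g y ∈ U k ↔ z ∈ U k}

theorem isClopen_setOf_mem_approxTree {Z : Type*} [TopologicalSpace Z] {U : ℕ → Set Z}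
    (hU : ∀ n, IsClopen (U n)) (g : (ℕ → ℕ) → Z) (t : List ℕ) :
    IsClopen {z | t ∈ approxTree U g z} := by
  refine isClopen_of_iff hU t.length ?_
  rintro x x' h ⟨y, hy, hyx⟩
  exact ⟨y, hy, fun k hk => (hyx k hk).trans (h k hk)⟩

theorem hasShift_approxTree_iff {Z : Type*} [TopologicalSpace Z] {U : ℕ → Set Z}
    (hU : ∀ n, IsClopen (U n)) (hsep : ∀ x y, (∀ n, x ∈ U n ↔ y ∈ U n) → x = y)
    {g : (ℕ → ℕ) → Z} (hg : Continuous g) (z : Z) :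
    HasShift (approxTree U g z) ↔ z ∈ range g := by
  constructor
  · intro h
    obtain ⟨u, huT, hlen, hmono⟩ := h.exists_chain
    choose y hy hyU using huT
    have hagree : ∀ m n, m ≤ n → ∀ k ≤ m, y n k = y m k := by
      intro m n hmn k hk
      have hs := hmono m n hmn
      rw [hy m, hy n] at hs
      exact (PiNat.eq_of_res_suffix_res hs (hk.trans_lt (hlen m))).symm
    -- The witnesses `y n` share ever longer initial segments, so they converge to their diagonal.
    -- Clopen sets and their complements pass to the limit, and separation identifies its image with
    -- `z`.
    have hlim : Filter.Tendsto y Filter.atTop (nhds fun k => y k k) := by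
      refine tendsto_pi_nhds.2 fun k => tendsto_const_nhds.congr' ?_
      filter_upwards [Filter.eventually_ge_atTop k] with n hn
      exact (hagree k n hn k le_rfl).symm
    have hglim := (hg.tendsto _).comp hlim
    refine ⟨fun k => y k k, hsep _ _ fun j => ?_⟩
    have hev : ∀ᶠ n in Filter.atTop, g (y n) ∈ U j ↔ z ∈ U j := by
      filter_upwards [Filter.eventually_ge_atTop j] with n hn
      exact hyU n j (hn.trans_lt (hlen n))
    by_cases hz : z ∈ U j
    · exact iff_of_true ((hU j).isClosed.mem_of_tendsto hglim (hev.mono fun n hn => hn.2 hz)) hz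
    · exact iff_of_false ((hU j).compl.isClosed.mem_of_tendsto hglim
        (hev.mono fun n hn => fun h => hz (hn.1 h))) hz
  · rintro ⟨b, rfl⟩
    exact hasShift_of_branch b fun n => ⟨b, by simp, fun _ _ => Iff.rfl⟩

theorem not_hasShift_empty : ¬ HasShift ∅ := by
  intro h
  obtain ⟨u, hu, -⟩ := h.exists_chain
  exact hu 0

theorem AnalyticSet.exists_hasShift_iff {Z : Type*} [TopologicalSpace Z] [PolishSpace Z]
    (hZ : TopologicalSpace.IsTopologicalBasis {s : Set Z | IsClopen s})
    {B : Set Z} (hB : AnalyticSet B) :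
    ∃ T : Z → Set (List ℕ), (∀ t, IsClopen {z | t ∈ T z}) ∧ ∀ z, HasShift (T z) ↔ z ∈ B := by
  rw [AnalyticSet] at hB
  rcases hB with rfl | ⟨g, hg, rfl⟩
  · exact ⟨fun _ => ∅, fun t => by simp [isClopen_empty], fun z => by simp [not_hasShift_empty]⟩
  · have : Nonempty Z := ⟨g 0⟩
    obtain ⟨U, hU, hsep⟩ := exists_isClopen_seq_separating hZ
    exact ⟨approxTree U g, isClopen_setOf_mem_approxTree hU g, hasShift_approxTree_iff hU hsep hg⟩

/-! ### Coding shifts by families of subsets of `ω` -/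

/-- The `n`-th finite sequence. -/
def nthSeq : ℕ → List ℕ := (Denumerable.eqv (List ℕ)).symm

theorem injJump_iff_hasShift {X : Type*} {S : X → X → Prop} {x y : ℕ → X} {T : Set (List ℕ)}
    (h : ∀ m n, S (x m) (y n) ↔ ExtendsIn T (nthSeq m) (nthSeq n)) :
    injJump S x y ↔ HasShift T := by
  let e := Denumerable.eqv (List ℕ)
  constructor
  · rintro ⟨f, hf, hS⟩
    refine ⟨e.symm ∘ f ∘ e, e.symm.injective.comp (hf.comp e.injective), fun s => ?_⟩
    simpa [nthSeq, e] using (h _ _).1 (hS (e s))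
  · rintro ⟨f, hf, hT⟩
    refine ⟨e ∘ f ∘ e.symm, e.injective.comp (hf.comp e.symm.injective), fun n => (h _ _).2 ?_⟩
    simpa [nthSeq, e] using hT (nthSeq n)

/-- The sequence of the sets `{m | t ≠ [] ∧ (s = t ∨ t ∈ T extends s)}`, where `s` and `t` are the
finite sequences with indices `m` and `n`. -/
def predSets (T : Set (List ℕ)) (n : ℕ) : Set ℕ := {m | ExtendsIn T (nthSeq m) (nthSeq n)}

/-- The complements of the sets of indices of sequences to which a shift may move the `n`-th one. -/
def nonSuccSets (T : Set (List ℕ)) (n : ℕ) : Set ℕ := {m | ¬ ExtendsIn T (nthSeq n) (nthSeq m)}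

/-- As `predSets`, without the exception for the empty sequence. -/
def reflPredSets (T : Set (List ℕ)) (n : ℕ) : Set ℕ :=
  {m | nthSeq m = nthSeq n ∨ (nthSeq m <:+ nthSeq n ∧ nthSeq n ∈ T)}

theorem isClopen_setOf_suffix_mem {Z : Type*} [TopologicalSpace Z] {T : Z → Set (List ℕ)}
    (hT : ∀ t, IsClopen {z | t ∈ T z}) (s t : List ℕ) :
    IsClopen {z | s = t ∨ (s <:+ t ∧ t ∈ T z)} := by
  by_cases h₁ : s = t
  · simp [h₁, isClopen_univ]
  by_cases h₂ : s <:+ t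
  · simpa [h₁, h₂] using hT t
  · simp [h₁, h₂, isClopen_empty]

theorem isClopen_setOf_extendsIn {Z : Type*} [TopologicalSpace Z] {T : Z → Set (List ℕ)}
    (hT : ∀ t, IsClopen {z | t ∈ T z}) (s t : List ℕ) : IsClopen {z | ExtendsIn (T z) s t} := by
  by_cases h : t = []
  · simp [ExtendsIn, h, isClopen_empty]
  · simpa [ExtendsIn, h] using isClopen_setOf_suffix_mem hT s t

theorem singleton_powIncl_predSets (T : Set (List ℕ)) (m n : ℕ) :
    powIncl {m} (predSets T n) ↔ ExtendsIn T (nthSeq m) (nthSeq n) := by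
  simp [powIncl, predSets]

theorem nonSuccSets_powIncl_compl (T : Set (List ℕ)) (m n : ℕ) :
    powIncl (nonSuccSets T m) {n}ᶜ ↔ ExtendsIn T (nthSeq m) (nthSeq n) := by
  simp [powIncl, nonSuccSets]

/-- Forward, test the inclusion at `m`, which the reflexive clause puts in the left set; backward,
extension is transitive. -/
theorem reflPredSets_powIncl_predSets (T : Set (List ℕ)) (m n : ℕ) :
    powIncl (reflPredSets T m) (predSets T n) ↔ ExtendsIn T (nthSeq m) (nthSeq n) := by
  constructor
  · intro h
    exact h (Or.inl rfl)
  · rintro ⟨hne, h⟩ k hk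
    refine ⟨hne, ?_⟩
    rcases h with h | ⟨h, hT⟩
    · exact h ▸ hk
    · rcases hk with hk | ⟨hk, -⟩
      · exact Or.inr ⟨hk ▸ h, hT⟩
      · exact Or.inr ⟨hk.trans h, hT⟩

/-- One half of the equivalence holds for every `T`, so only the other half carries information. -/
theorem predSets_injJump_reflPredSets (T : Set (List ℕ)) :
    injJump powIncl (predSets T) (reflPredSets T) :=
  ⟨id, Function.injective_id, fun _ _ h => h.2⟩

/-! ### Completeness -/

theorem isSigma11Complete_of_hasShift {X : Type*} [TopologicalSpace X] [PolishSpace X] {A : Set X}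
    (hA : AnalyticSet A) (F : Set (List ℕ) → X) (hF : ∀ T, F T ∈ A ↔ HasShift T)
    (hcont : ∀ (Z : Type) [TopologicalSpace Z] (T : Z → Set (List ℕ)),
      (∀ t, IsClopen {z | t ∈ T z}) → Continuous fun z => F (T z)) :
    IsSigma11Complete A := by
  refine ⟨hA, fun Z _ _ hZ B hB => ?_⟩
  obtain ⟨T, hT, hTB⟩ := AnalyticSet.exists_hasShift_iff hZ hB
  refine ⟨fun z => F (T z), hcont Z T hT, ?_⟩
  ext z
  exact (hF _).trans (hTB z)

theorem continuous_predSets {Z : Type*} [TopologicalSpace Z] {T : Z → Set (List ℕ)}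
    (hT : ∀ t, IsClopen {z | t ∈ T z}) : Continuous fun z => predSets (T z) :=
  continuous_pi fun _ => continuous_set_nat fun _ => isClopen_setOf_extendsIn hT _ _

theorem continuous_nonSuccSets {Z : Type*} [TopologicalSpace Z] {T : Z → Set (List ℕ)}
    (hT : ∀ t, IsClopen {z | t ∈ T z}) : Continuous fun z => nonSuccSets (T z) :=
  continuous_pi fun _ => continuous_set_nat fun _ => (isClopen_setOf_extendsIn hT _ _).compl

theorem continuous_reflPredSets {Z : Type*} [TopologicalSpace Z] {T : Z → Set (List ℕ)}
    (hT : ∀ t, IsClopen {z | t ∈ T z}) : Continuous fun z => reflPredSets (T z) :=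
  continuous_pi fun _ => continuous_set_nat fun _ => isClopen_setOf_suffix_mem hT _ _

theorem analyticSet_relGraph_injJump_powIncl : AnalyticSet (relGraph (injJump powIncl)) :=
  isClosed_relGraph_powIncl.analyticSet_relGraph_injJump

theorem isSigma11Complete_upperCone_singletons :
    IsSigma11Complete (upperCone (injJump powIncl) (fun n : ℕ => ({n} : Set ℕ))) :=
  isSigma11Complete_of_hasShift
    (analyticSet_relGraph_injJump_powIncl.preimage
      (Continuous.prodMk_right fun n : ℕ => ({n} : Set ℕ)))
    predSets (fun T => injJump_iff_hasShift (singleton_powIncl_predSets T))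
    (fun _ _ _ => continuous_predSets)

theorem isSigma11Complete_relGraph_injJump_powIncl :
    IsSigma11Complete (relGraph (injJump powIncl)) :=
  isSigma11Complete_of_hasShift analyticSet_relGraph_injJump_powIncl
    (fun T => (fun n : ℕ => ({n} : Set ℕ), predSets T))
    (fun T => injJump_iff_hasShift (singleton_powIncl_predSets T))
    (fun _ _ _ hT => continuous_const.prodMk (continuous_predSets hT))

theorem isSigma11Complete_lowerCone_compl_singletons :
    IsSigma11Complete (lowerCone (injJump powIncl) (fun n : ℕ => ({n}ᶜ : Set ℕ))) :=
  isSigma11Complete_of_hasShift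
    (analyticSet_relGraph_injJump_powIncl.preimage
      (Continuous.prodMk_left fun n : ℕ => ({n}ᶜ : Set ℕ)))
    nonSuccSets (fun T => injJump_iff_hasShift (nonSuccSets_powIncl_compl T))
    (fun _ _ _ => continuous_nonSuccSets)

theorem isSigma11Complete_relGraph_assocEquiv_injJump_powIncl :
    IsSigma11Complete (relGraph (assocEquiv (injJump powIncl))) :=
  isSigma11Complete_of_hasShift
    (AnalyticSet.relGraph_assocEquiv analyticSet_relGraph_injJump_powIncl)
    (fun T => (reflPredSets T, predSets T))
    (fun T => (and_iff_left (predSets_injJump_reflPredSets T)).trans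
      (injJump_iff_hasShift (reflPredSets_powIncl_predSets T)))
    (fun _ _ _ hT => (continuous_reflPredSets hT).prodMk (continuous_predSets hT))

/-! ### Complete analytic sets are not Borel -/

instance instPolishSpaceBool : PolishSpace Bool :=
  (Topology.IsClosedEmbedding.of_continuous_injective_isClosedMap (f := Bool.toNat)
    continuous_of_discreteTopology (by decide) (fun _ _ => isClosed_discrete _)).polishSpace

/-- Some analytic subset of the Cantor space has a complement that is not analytic. -/
theorem exists_analyticSet_not_analyticSet_compl :
    ∃ B : Set (ℕ → Bool), AnalyticSet B ∧ ¬ AnalyticSet Bᶜ := by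
  obtain ⟨b, hbc, -, hbasis⟩ :=
    TopologicalSpace.exists_countable_basis ((ℕ → Bool) × (ℕ → ℕ))
  have hne : b.Nonempty := by
    obtain ⟨s, hs, -⟩ := hbasis.exists_subset_of_mem_open
      (mem_univ ((fun _ => false : ℕ → Bool), (0 : ℕ → ℕ))) isOpen_univ
    exact ⟨s, hs⟩
  obtain ⟨W, rfl⟩ := hbc.exists_eq_range hne
  -- A universal closed set: `w.1` lists basic open sets that `w` must avoid.
  have hclosed : IsClosed {w : (ℕ → Bool) × (ℕ → ℕ) | ∀ n, w.1 n = true → w ∉ W n} := by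
    simp only [ofPred_forall, imp_iff_not_or, ofPred_or]
    refine isClosed_iInter fun n => IsClosed.union ?_ ?_
    · have hc : Continuous fun w : (ℕ → Bool) × (ℕ → ℕ) => w.1 n := by fun_prop
      exact (isClosed_discrete {true}ᶜ).preimage hc
    · exact (hbasis.isOpen ⟨n, rfl⟩).isClosed_compl
  refine ⟨Prod.fst '' {w : (ℕ → Bool) × (ℕ → ℕ) | ∀ n, w.1 n = true → w ∉ W n},
    hclosed.analyticSet.image_of_continuous continuous_fst, fun hB => ?_⟩
  obtain ⟨F, hF, hFB⟩ : ∃ F : Set ((ℕ → Bool) × (ℕ → ℕ)), IsClosed F ∧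
      Prod.fst '' F = (Prod.fst '' {w : (ℕ → Bool) × (ℕ → ℕ) | ∀ n, w.1 n = true → w ∉ W n})ᶜ := by
    rw [AnalyticSet] at hB
    rcases hB with hB | ⟨g, hg, hB⟩
    · exact ⟨∅, isClosed_empty, by rw [hB, image_empty]⟩
    · refine ⟨{w | g w.2 = w.1}, isClosed_eq (by fun_prop) (by fun_prop), ?_⟩
      rw [← hB]
      ext z
      simp
  obtain ⟨S, hS, hFS⟩ := hbasis.open_eq_sUnion hF.isOpen_compl
  classical
  -- The code of the complement of `F`: over `c`, `F` and the universal set have the same section,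
  -- so `c` lies in both projections or in neither, although these are complementary.
  let c : ℕ → Bool := fun n => decide (W n ∈ S)
  have hc : ∀ y, (c, y) ∈ F ↔ ∀ n, c n = true → (c, y) ∉ W n := by
    intro y
    rw [← not_iff_not, ← mem_compl_iff, hFS]
    simp only [mem_sUnion, c, decide_eq_true_eq, not_forall, not_not, exists_prop]
    constructor
    · rintro ⟨s, hs, hy⟩
      obtain ⟨n, rfl⟩ := hS hs
      exact ⟨n, hs, hy⟩
    · rintro ⟨n, hn, hy⟩
      exact ⟨_, hn, hy⟩
  have hiff := Set.ext_iff.1 hFB c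
  have hmem : c ∈ Prod.fst '' F ↔
      c ∈ Prod.fst '' {w : (ℕ → Bool) × (ℕ → ℕ) | ∀ n, w.1 n = true → w ∉ W n} := by
    simp [hc]
  exact iff_not_self (hmem.symm.trans hiff)

/-- Otherwise the complement of `A` would be analytic, and so would its continuous preimage, the
complement of `B`. -/
theorem IsSigma11Complete.not_measurableSet_borel {X : Type*} [TopologicalSpace X] [PolishSpace X]
    {A : Set X} (hA : IsSigma11Complete A) : ¬ MeasurableSet[borel X] A := by
  intro hm
  obtain ⟨B, hB, hBc⟩ := exists_analyticSet_not_analyticSet_compl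
  obtain ⟨f, hf, rfl⟩ := hA.2 (ℕ → Bool) isTopologicalBasis_isClopen B hB
  let _ : MeasurableSpace X := borel X
  have : BorelSpace X := ⟨rfl⟩
  exact hBc (AnalyticSet.preimage (MeasurableSet.analyticSet hm.compl) hf)

theorem mainTheorem9 :
    -- the upper cone generated by the singletons
    IsSigma11Complete (upperCone (injJump powIncl) (fun n : ℕ => ({n} : Set ℕ))) ∧
    -- the jump as a subset of the square
    IsSigma11Complete (relGraph (injJump powIncl)) ∧
    -- the lower cone generated by the complements of singletons
    IsSigma11Complete (lowerCone (injJump powIncl) (fun n : ℕ => ({n}ᶜ : Set ℕ))) ∧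
    -- the associated equivalence relation
    IsSigma11Complete (relGraph (assocEquiv (injJump powIncl))) ∧
    -- inclusion is a Borel quasi-order whose jump is proper analytic
    IsBorelQuasiOrder powIncl ∧ IsProperAnalyticQuasiOrder (injJump powIncl) := by
  refine ⟨isSigma11Complete_upperCone_singletons, isSigma11Complete_relGraph_injJump_powIncl,
    isSigma11Complete_lowerCone_compl_singletons,
    isSigma11Complete_relGraph_assocEquiv_injJump_powIncl, ⟨powIncl_isPreorder, ?_⟩,
    injJump_isPreorder _ powIncl_isPreorder, analyticSet_relGraph_injJump_powIncl,
    isSigma11Complete_relGraph_injJump_powIncl.not_measurableSet_borel⟩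
  let _ : MeasurableSpace (Set ℕ × Set ℕ) := borel _
  have : BorelSpace (Set ℕ × Set ℕ) := ⟨rfl⟩
  exact isClosed_relGraph_powIncl.measurableSet
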